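/- **Setting.** Let $\Lambda\subset\mathbb R^d$ be a discrete subgroup ($\Lambda=0$ gives $\mathbb R^d$, $\Lambda=\mathbb Z^d$ gives the torus), and let $\mathcal D$ be a bounded connected domain in $\mathbb R^d/\Lambda$ whose boundary is a finite union of compact $C^3$ hypersurfaces $\Gamma_1,\dots,\Gamma_r$, each possibly with boundary (and corners). A point $q\in\partial\mathcal D$ is called regular if near $q$ the set $\mathcal D$ is one side of a $C^3$ hypersurface; then $\nu(q)$ denotes the unit normal vector pointing into $\mathcal D$, and $\mathcal K_q=d\nu(q)$ the curvature operator on the tangent space of $\partial\mathcal D$ at $q$. The billiard in $\mathcal D$ is semi-dispersing: $\mathcal K_q\ge 0$ at every regular $q\in\partial\mathcal D$. Let $\Phi^t$ be the billiard flow (unit speed, specular reflections) on the phase space $\Omega=\mathcal D\times S^{d-1}$, with the Euclidean inner product $\langle(\delta q,\delta v),(z,w)\rangle=\langle\delta q,z\rangle+\langle\delta v,w\rangle$ on its tangent spaces $\mathcal T_{(q,v)}\Omega=\{(\delta q,\delta v):\delta v\perp v\}$. Let $J\subset\Omega$ be a compact $C^1$ hypersurface, possibly with boundary (and corners), which is locally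 flow-invariant: for every $x\in J\setminus\partial J$ there is $\varepsilon>0$ with $\Phi^tx\in J$ for all $|t|<\varepsilon$. Let $n_0(y)=(z_0(y),w_0(y))\in\mathcal T_y\Omega$, $y\in J$, be a field of unit normal vectors to $J$, and suppose that for a constant $c_0>0$ $$Q(n_0(y)):=\langle z_0(y),w_0(y)\rangle\le -c_0<0\qquad\text{for all } y\in J .$$ **Theorem.** Let $y\in J$ and $t\ge 1/c_0$ be such that the trajectory of $y$ on $[0,t]$ meets $\partial\mathcal D$ only finitely many times, each time at a regular point and not tangentially, and $t$ is not a moment of reflection. Then $\Phi^t$ is differentiable at $y$, and it expands the volume of $J$ at $y$ by a factor $$\lambda_t\ge 1+c_0t,$$ where $\lambda_t=\sqrt{\det(A^{\mathsf T}A)}$, $A=D_y\Phi^t|_{\mathcal T_yJ}$, is the Jacobian at $y$ of the restriction of $\Phi^t$ to $J$. In particular, the expansion is at least linear in $t$. -/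

import Mathlib

open Set Filter Topology

noncomputable section

namespace SemiDispersing

/-- The Euclidean space `ℝ^d`. -/
abbrev Space (d : ℕ) := EuclideanSpace ℝ (Fin d)

/-- The configuration manifold `ℝ^d / Λ`: for `Λ = 0` it is `ℝ^d`, for `Λ = ℤ^d` the torus. -/
abbrev Config {d : ℕ} (Λ : AddSubgroup (Space d)) := Space d ⧸ Λ

/-- Pairs `(q, v)` of vectors of `ℝ^d` with the Euclidean inner product
`⟨(δq, δv), (z, w)⟩ = ⟨δq, z⟩ + ⟨δv, w⟩`. -/
abbrev Phase (d : ℕ) := WithLp 2 (Space d × Space d)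

/-- The phase vector with components `q` and `v`. -/
def pt {d : ℕ} (q v : Space d) : Phase d := WithLp.toLp 2 (q, v)

/-- The lift to `ℝ^d` of a subset of `ℝ^d / Λ`. -/
def liftConfig {d : ℕ} {Λ : AddSubgroup (Space d)} (S : Set (Config Λ)) : Set (Space d) :=
  {q | (QuotientAddGroup.mk q : Config Λ) ∈ S}

/-- The covering map `ℝ^d × ℝ^d → (ℝ^d / Λ) × ℝ^d`. -/
def proj {d : ℕ} (Λ : AddSubgroup (Space d)) (x : Phase d) : Config Λ × Space d :=
  (QuotientAddGroup.mk x.fst, x.snd)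

/-- The lift to `ℝ^d × ℝ^d` of a subset of `(ℝ^d / Λ) × ℝ^d`. -/
def liftPhase {d : ℕ} {Λ : AddSubgroup (Space d)} (S : Set (Config Λ × Space d)) :
    Set (Phase d) :=
  proj Λ ⁻¹' S

/-! ### Hypersurfaces with boundary -/

/-- Let `M` be a submanifold of `V` with tangent space `T` at `x`. Near `x`, the set `S` is a `C^n`
hypersurface of `M`, cut out by one equation `f 0 = 0` and `k` inequalities `f (j + 1) ≥ 0`, with
all these functions vanishing at `x` and having independent differentials on `T`. For `k = 0` the
point `x` is an interior point of the hypersurface, for `k = 1` a boundary point, for `k ≥ 2` a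
corner. -/
def IsHypersurfaceNear {V : Type*} [NormedAddCommGroup V] [NormedSpace ℝ V] (n : ℕ)
    (M : Set V) (T : Submodule ℝ V) (S : Set V) (k : ℕ) (x : V) : Prop :=
  ∃ f : Fin (k + 1) → V → ℝ,
    (∀ i, f i x = 0) ∧ (∀ i, ContDiffAt ℝ n (f i) x) ∧
    LinearIndependent ℝ (fun i => (fderiv ℝ (f i) x).comp T.subtypeL) ∧
    ∀ᶠ y in 𝓝 x, y ∈ S ↔ y ∈ M ∧ f 0 y = 0 ∧ ∀ j : Fin k, 0 ≤ f j.succ y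

/-- The tangent space of `S` at `x`: the linear span of all limits of directions of `S` at `x`. -/
def tangentSpace {V : Type*} [NormedAddCommGroup V] [NormedSpace ℝ V] (S : Set V) (x : V) :
    Submodule ℝ V :=
  Submodule.span ℝ (tangentConeAt ℝ S x)

/-! ### Billiard tables -/

/-- A billiard table in `ℝ^d / Λ`: a bounded connected domain whose boundary is a finite union of
compact `C^3` hypersurfaces, possibly with boundary (and corners). -/
structure Table (d : ℕ) (Λ : AddSubgroup (Space d)) where
  /-- the domain -/
  dom : Set (Config Λ)
  isOpen_dom : IsOpen dom
  isConnected_dom : IsConnected dom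
  isCompact_closure_dom : IsCompact (closure dom)
  /-- the number of boundary components -/
  r : ℕ
  /-- the boundary components -/
  Γ : Fin r → Set (Config Λ)
  isCompact_Γ : ∀ i, IsCompact (Γ i)
  hypersurface_Γ : ∀ i, ∀ q ∈ liftConfig (Γ i),
    ∃ k, IsHypersurfaceNear 3 univ ⊤ (liftConfig (Γ i)) k q
  frontier_dom : frontier dom = ⋃ i, Γ i

/-- `F` is a `C^3` function with nonzero gradient at its zero `q`, and near `q` the set `D` is the
side `F > 0` of the hypersurface `F = 0`. The points `q` with such an `F` are the regular points of
the boundary of `D`. -/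
structure IsDefiningFunction {d : ℕ} (D : Set (Space d)) (q : Space d) (F : Space d → ℝ) :
    Prop where
  zero : F q = 0
  contDiffAt : ContDiffAt ℝ 3 F q
  gradient_ne_zero : gradient F q ≠ 0
  mem_iff : ∀ᶠ y in 𝓝 q, y ∈ D ↔ 0 < F y

/-- The field of unit normal vectors to the level sets of `F`, pointing to where `F` increases. -/
def unitNormal {d : ℕ} (F : Space d → ℝ) (q : Space d) : Space d :=
  ‖gradient F q‖⁻¹ • gradient F q

/-- `q` is a regular boundary point of `D`, and `ν` is the unit normal vector there that points
into `D`. -/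
def IsInwardNormal {d : ℕ} (D : Set (Space d)) (q ν : Space d) : Prop :=
  ∃ F, IsDefiningFunction D q F ∧ ν = unitNormal F q

/-- The table is semi-dispersing: at every regular boundary point, the curvature operator
`K u = (dν)(u)` of the boundary with respect to the inward unit normal field `ν` is positive
semi-definite on the tangent space of the boundary. -/
def Table.IsSemiDispersing {d : ℕ} {Λ : AddSubgroup (Space d)} (B : Table d Λ) : Prop :=
  ∀ q F, IsDefiningFunction (liftConfig B.dom) q F →
    ∀ u : Space d, inner ℝ u (unitNormal F q) = 0 →
      0 ≤ inner ℝ (fderiv ℝ (unitNormal F) q u) u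

/-! ### The billiard flow -/

/-- The specular reflection of the velocity `v` in the hyperplane orthogonal to the unit
vector `ν`. -/
def reflect {d : ℕ} (ν v : Space d) : Space d := v - (2 * inner ℝ v ν) • ν

/-- `Reach D t x y`: the billiard trajectory in `D` that starts at `x` is, on the time interval
`[0, t]`, a concatenation of free flights and of finitely many specular reflections, each at a
regular boundary point and not tangential, and it is at `y` at time `t` (after the reflection, if
there is one at time `t`). -/
inductive Reach {d : ℕ} (D : Set (Space d)) : ℝ → Phase d → Phase d → Prop
  | free (q v : Space d) (t : ℝ) (ht : 0 ≤ t) (hfree : ∀ s ∈ Ioc 0 t, q + s • v ∈ D) :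
      Reach D t (pt q v) (pt (q + t • v) v)
  | collide (q v ν : Space d) (τ t : ℝ) (y : Phase d) (hτ : 0 < τ)
      (hfree : ∀ s ∈ Ioo 0 τ, q + s • v ∈ D)
      (hν : IsInwardNormal D (q + τ • v) ν) (htrans : inner ℝ v ν < 0)
      (hrest : Reach D t (pt (q + τ • v) (reflect ν v)) y) :
      Reach D (τ + t) (pt q v) y

open Classical in
/-- The time-`t` map of the billiard flow in `D` for `t ≥ 0`; by convention it is the identity
where no trajectory as in `Reach` exists. -/
def forwardFlow {d : ℕ} (D : Set (Space d)) (t : ℝ) (x : Phase d) : Phase d :=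
  if h : ∃ y, Reach D t x y then h.choose else x

/-- Reversal of the velocity. -/
def reverse {d : ℕ} (x : Phase d) : Phase d := pt x.fst (-x.snd)

open Classical in
/-- The (lifted) billiard flow `Φ^t`, `t ∈ ℝ`. For negative times it is given by the reversibility
of the billiard motion. -/
def Table.flow {d : ℕ} {Λ : AddSubgroup (Space d)} (B : Table d Λ) (t : ℝ) (x : Phase d) :
    Phase d :=
  if 0 ≤ t then forwardFlow (liftConfig B.dom) t x
  else reverse (forwardFlow (liftConfig B.dom) (-t) (reverse x))

/-- The (lifted) phase space `Ω = D × S^{d-1}`. -/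
def Table.phaseSpace {d : ℕ} {Λ : AddSubgroup (Space d)} (B : Table d Λ) : Set (Phase d) :=
  {x | x.fst ∈ liftConfig B.dom ∧ ‖x.snd‖ = 1}

/-- The tangent space `{(δq, δv) | δv ⊥ v}` of the phase space at `(q, v)`. -/
def phaseTangent {d : ℕ} (x : Phase d) : Submodule ℝ (Phase d) where
  carrier := {u | inner ℝ u.snd x.snd = 0}
  add_mem' := by
    intro a b ha hb
    simp only [mem_ofPred_eq, WithLp.add_snd, inner_add_left] at *
    rw [ha, hb, add_zero]
  zero_mem' := by simp
  smul_mem' := by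
    intro c a ha
    simp only [mem_ofPred_eq, WithLp.smul_snd, real_inner_smul_left] at *
    rw [ha, mul_zero]

/-- The trajectory of `x` on `[0, t]` meets the boundary only finitely often, at regular points and
not tangentially, and at time `t` it is inside the domain (`t` is not a moment of reflection). -/
def Table.IsRegularUpTo {d : ℕ} {Λ : AddSubgroup (Space d)} (B : Table d Λ) (t : ℝ)
    (x : Phase d) : Prop :=
  ∃ y, Reach (liftConfig B.dom) t x y ∧ y.fst ∈ liftConfig B.dom

/-! ### Flow-invariant hypersurfaces -/

/-- `J` is a locally flow-invariant compact `C^1` hypersurface, possibly with boundary (and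
corners), in the phase space: every interior point of `J` stays in `J` for small times. -/
structure Table.IsInvariantHypersurface {d : ℕ} {Λ : AddSubgroup (Space d)} (B : Table d Λ)
    (J : Set (Config Λ × Space d)) : Prop where
  subset : liftPhase J ⊆ B.phaseSpace
  isCompact : IsCompact J
  hypersurface : ∀ x ∈ liftPhase J,
    ∃ k, IsHypersurfaceNear 1 B.phaseSpace (phaseTangent x) (liftPhase J) k x
  invariant : ∀ x ∈ liftPhase J,
    IsHypersurfaceNear 1 B.phaseSpace (phaseTangent x) (liftPhase J) 0 x →
    ∃ ε > 0, ∀ t : ℝ, |t| < ε → B.flow t x ∈ liftPhase J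

/-- `n` is a unit normal vector at `x` to the hypersurface `S` of the phase space: `n` is tangent
to the phase space, has norm one, and a tangent vector `u` of the phase space is tangent to `S` if
and only if `⟨u, n⟩ = 0`. -/
def IsUnitNormal {d : ℕ} (S : Set (Phase d)) (x n : Phase d) : Prop :=
  n ∈ phaseTangent x ∧ ‖n‖ = 1 ∧
    ∀ u, u ∈ tangentSpace S x ↔ u ∈ phaseTangent x ∧ inner ℝ u n = 0

/-- The infinitesimal Lyapunov function `Q(z, w) = ⟨z, w⟩`. -/
def lyapunov {d : ℕ} (n : Phase d) : ℝ := inner ℝ n.fst n.snd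

/-- The factor `√(det (Aᵀ A))`, with `A` the restriction of `L` to `W`, by which the linear map `L`
changes volumes on the subspace `W`. -/
def volumeFactor {V : Type*} [NormedAddCommGroup V] [InnerProductSpace ℝ V]
    [FiniteDimensional ℝ V] (L : V →ₗ[ℝ] V) (W : Submodule ℝ V) : ℝ :=
  √(LinearMap.det (LinearMap.adjoint (L ∘ₗ W.subtype) ∘ₗ (L ∘ₗ W.subtype)))

/-- The factor by which the map `Φ` expands the volume of the submanifold `S` at `x`: the Jacobian
at `x` of the restriction of `Φ` to `S`. -/
def expansionFactor {V : Type*} [NormedAddCommGroup V] [InnerProductSpace ℝ V]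
    [FiniteDimensional ℝ V] (Φ : V → V) (S : Set V) (x : V) : ℝ :=
  volumeFactor (fderivWithin ℝ Φ S x : V →ₗ[ℝ] V) (tangentSpace S x)

/-! ### The flow is well defined: the trajectory of a phase point is unique -/

lemma ray_pos {d : ℕ} {F : Space d → ℝ} {q u : Space d} (h0 : F q = 0)
    (hF : DifferentiableAt ℝ F q) (hu : 0 < inner ℝ (gradient F q) u) :
    ∀ᶠ s in 𝓝[>] (0 : ℝ), 0 < F (q + s • u) := by
  have h1 : HasDerivAt (fun s : ℝ => F (q + s • u)) (inner ℝ (gradient F q) u) 0 := by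
    have hg : HasFDerivAt F (fderiv ℝ F q) (q + (0 : ℝ) • u) := by simpa using hF.hasFDerivAt
    have hl : HasDerivAt (fun s : ℝ => q + s • u) u 0 := by
      simpa using ((hasDerivAt_id (0 : ℝ)).smul_const u).const_add q
    have := hg.comp_hasDerivAt (0 : ℝ) hl
    have e : inner ℝ (gradient F q) u = fderiv ℝ F q u := by simp [gradient]
    rw [e]
    exact this
  have h2 := h1.tendsto_slope.mono_left
    (nhdsWithin_mono (0 : ℝ) (fun s (hs : 0 < s) => hs.ne'))
  filter_upwards [h2.eventually (lt_mem_nhds hu), self_mem_nhdsWithin] with s hs hs0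
  have hs0' : 0 < s := hs0
  simp only [slope_def_field, zero_smul, add_zero, h0, sub_zero] at hs
  exact (div_pos_iff_of_pos_right hs0').1 hs

lemma gradient_neg' {d : ℕ} (F : Space d → ℝ) (q : Space d) :
    gradient (fun y => -F y) q = -gradient F q := by
  simp [gradient, fderiv_fun_neg]

lemma IsInwardNormal.unique {d : ℕ} {D : Set (Space d)} {q ν ν' : Space d}
    (h : IsInwardNormal D q ν) (h' : IsInwardNormal D q ν') : ν = ν' := by
  obtain ⟨F, hF, rfl⟩ := h
  obtain ⟨G, hG, rfl⟩ := h'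
  by_contra hne
  have hnF : ‖unitNormal F q‖ = 1 := by
    simp [unitNormal, norm_smul, norm_ne_zero_iff.2 hF.gradient_ne_zero]
  have hnG : ‖unitNormal G q‖ = 1 := by
    simp [unitNormal, norm_smul, norm_ne_zero_iff.2 hG.gradient_ne_zero]
  have hlt : inner ℝ (unitNormal F q) (unitNormal G q) < 1 :=
    (inner_lt_one_iff_real_of_norm_eq_one hnF hnG).2 hne
  have eF : gradient F q = ‖gradient F q‖ • unitNormal F q := by
    simp [unitNormal, smul_smul, norm_ne_zero_iff.2 hF.gradient_ne_zero]
  have eG : gradient G q = ‖gradient G q‖ • unitNormal G q := by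
    simp [unitNormal, smul_smul, norm_ne_zero_iff.2 hG.gradient_ne_zero]
  have pF := norm_pos_iff.2 hF.gradient_ne_zero
  have pG := norm_pos_iff.2 hG.gradient_ne_zero
  have a1 := ray_pos (u := unitNormal F q - unitNormal G q) hF.zero
    (hF.contDiffAt.differentiableAt (by norm_num)) (by
      rw [eF, real_inner_smul_left, inner_sub_right, real_inner_self_eq_norm_sq, hnF]
      exact mul_pos pF (by linarith))
  have a2 := ray_pos (F := fun y => -G y) (u := unitNormal F q - unitNormal G q)
    (by simp [hG.zero]) (hG.contDiffAt.differentiableAt (by norm_num)).neg (by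
      rw [gradient_neg', inner_neg_left, eG, real_inner_smul_left, inner_sub_right,
        real_inner_self_eq_norm_sq, hnG, real_inner_comm, ← mul_neg]
      exact mul_pos pG (by linarith))
  have ht : Tendsto (fun s : ℝ => q + s • (unitNormal F q - unitNormal G q)) (𝓝[>] 0) (𝓝 q) := by
    have : Continuous (fun s : ℝ => q + s • (unitNormal F q - unitNormal G q)) := by fun_prop
    simpa using (this.tendsto 0).mono_left nhdsWithin_le_nhds
  obtain ⟨s, h1, h2, h3, h4⟩ :=
    (a1.and (a2.and ((ht.eventually hF.mem_iff).and (ht.eventually hG.mem_iff)))).exists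
  have := h4.1 (h3.2 h1)
  linarith

lemma IsInwardNormal.notMem {d : ℕ} {D : Set (Space d)} {q ν : Space d}
    (h : IsInwardNormal D q ν) : q ∉ D := by
  obtain ⟨F, hF, rfl⟩ := h
  intro hq
  have := hF.mem_iff.self_of_nhds.1 hq
  exact absurd hF.zero this.ne'

lemma pt_inj {d : ℕ} {q v q' v' : Space d} (h : pt q v = pt q' v') : q = q' ∧ v = v' := by
  simpa [pt] using h

lemma Reach.nonneg {d : ℕ} {D : Set (Space d)} {t : ℝ} {x y : Phase d} (h : Reach D t x y) :
    0 ≤ t := by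
  induction h with
  | free q v t ht hfree => exact ht
  | collide q v ν τ t y hτ hfree hν htrans hrest ih => linarith

/-- The trajectory is determined by its starting point. -/
theorem Reach.unique {d : ℕ} {D : Set (Space d)} {t : ℝ} {x y y' : Phase d}
    (h : Reach D t x y) (h' : Reach D t x y') : y = y' := by
  induction h generalizing y' with
  | free q v t ht hfree =>
    generalize hx : pt q v = x at h'
    cases h' with
    | free q' v' _ _ _ => obtain ⟨rfl, rfl⟩ := pt_inj hx; rfl
    | collide q' v' ν τ t' _ hτ hfree' hν htrans hrest =>
      obtain ⟨rfl, rfl⟩ := pt_inj hx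
      exact absurd (hfree τ ⟨hτ, by linarith [hrest.nonneg]⟩) hν.notMem
  | collide q v ν τ t y hτ hfree hν htrans hrest ih =>
    generalize hx : pt q v = x at h'
    generalize hT : τ + t = T at h'
    cases h' with
    | free q' v' _ _ hfree' =>
      obtain ⟨rfl, rfl⟩ := pt_inj hx
      exact absurd (hfree' τ ⟨hτ, by linarith [hrest.nonneg]⟩) hν.notMem
    | collide q' v' ν' τ' t' _ hτ' hfree' hν' htrans' hrest' =>
      obtain ⟨rfl, rfl⟩ := pt_inj hx
      have e : τ = τ' := by
        rcases lt_trichotomy τ τ' with h | h | h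
        · exact absurd (hfree' τ ⟨hτ, h⟩) hν.notMem
        · exact h
        · exact absurd (hfree τ' ⟨hτ', h⟩) hν'.notMem
      subst e
      obtain rfl := hν.unique hν'
      obtain rfl : t = t' := by linarith
      exact ih hrest'

/-- The flow follows the trajectories. -/
theorem forwardFlow_eq {d : ℕ} {D : Set (Space d)} {t : ℝ} {x y : Phase d}
    (h : Reach D t x y) : forwardFlow D t x = y := by
  have hex : ∃ y, Reach D t x y := ⟨y, h⟩
  rw [forwardFlow, dif_pos hex]
  exact hex.choose_spec.unique h

end SemiDispersing

end

noncomputable section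

namespace SemiDispersing

/-! ### Volume factors of linear maps -/

/-! A linear map of determinant ±1 loses across a hyperplane what it gains along it. So the Jacobian
of `Φ^t` on `J` is the norm of the covector obtained by transporting the unit normal with the
inverse transpose of the derivative (`volumeFactor_eq_norm`), and it suffices to follow one covector
(z, w) along the trajectory.

A free flight of length s sends it to (z, w - s z), which lowers Q = ⟨z, w⟩ by s‖z‖². A collision
reflects it and adds a curvature term that keeps ‖w‖ and, since K ≥ 0, cannot raise Q. Hence a bound
u ≤ -Q/‖w‖ persists, and under it ‖w‖ grows by at least u per unit time. `Dispersive` records this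
in a form stable under composition (`dispersive_flight`, `dispersive_collision`, `Dispersive.comp`).
Starting with ω = ‖w‖ and u = c₀/ω, one ends with ‖w‖ ≥ ω + c₀t/ω, which gives 1 + c₀t once c₀t ≥ 1
(`Dispersive.le_volumeFactor`).

Differentiability comes from the implicit function theorem for the collision time
(`exists_collisionTime`) and an induction along the trajectory (`Reach.exists_hasFDerivAt`).
Derivatives are taken in the whole space of pairs (q, v), without fixing the speed. -/

lemma det_adjoint_real {V : Type*} [NormedAddCommGroup V] [InnerProductSpace ℝ V]
    [FiniteDimensional ℝ V] (M : V →ₗ[ℝ] V) :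
    LinearMap.det (LinearMap.adjoint M) = LinearMap.det M := by
  let b := stdOrthonormalBasis ℝ V
  rw [← LinearMap.det_toMatrix b.toBasis, ← LinearMap.det_toMatrix b.toBasis M,
    LinearMap.toMatrix_adjoint, Matrix.det_conjTranspose]
  simp

/-- If `M` agrees with `L` on `W`, maps `Wᗮ` isometrically and keeps the images of `W` and `Wᗮ`
orthogonal, then `L` changes volumes on `W` by the factor `|det M|`. -/
lemma volumeFactor_eq_abs_det {V : Type*} [NormedAddCommGroup V] [InnerProductSpace ℝ V]
    [FiniteDimensional ℝ V] (L M : V →ₗ[ℝ] V) (W : Submodule ℝ V) (hML : ∀ x ∈ W, M x = L x)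
    (hM : ∀ x, ∀ y ∈ Wᗮ, inner ℝ (M x) (M y) = inner ℝ x y) :
    volumeFactor L W = |LinearMap.det M| := by
  set G : V →ₗ[ℝ] V := LinearMap.adjoint M ∘ₗ M with hG
  -- `hM` makes G - 1 take values orthogonal to `Wᗮ`. So G induces the identity on V/W, and its
  -- whole determinant comes from W.
  have hsub : ∀ x, G x - x ∈ W := by
    intro x
    rw [← Submodule.orthogonal_orthogonal W, Submodule.mem_orthogonal']
    intro y hy
    rw [inner_sub_left, hG, LinearMap.comp_apply, LinearMap.adjoint_inner_left, hM x y hy, sub_self]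
  have hinv : W ≤ W.comap G := fun x hx => by
    have := W.add_mem (hsub x) hx
    simpa using this
  have hquot : W.mapQ W G hinv = LinearMap.id := by
    ext x
    simpa [Submodule.Quotient.eq] using hsub x
  have hres : LinearMap.adjoint (L ∘ₗ W.subtype) ∘ₗ (L ∘ₗ W.subtype) = G.restrict hinv := by
    ext1 x
    refine ext_inner_right ℝ fun y => ?_
    have h1 : inner ℝ (G x) (y : V) = inner ℝ (L x) (L y) := by
      rw [hG, LinearMap.comp_apply, LinearMap.adjoint_inner_left, hML x x.2, hML y y.2]
    rw [LinearMap.comp_apply, LinearMap.adjoint_inner_left]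
    exact h1.symm
  have hdet : LinearMap.det G = LinearMap.det M * LinearMap.det M := by
    rw [hG, LinearMap.det_comp, det_adjoint_real]
  have := LinearMap.det_eq_det_mul_det W G hinv
  rw [hquot, LinearMap.det_id, mul_one] at this
  rw [volumeFactor, hres, ← this, hdet, Real.sqrt_mul_self_eq_abs]

/-- Let `L` map the hyperplane `eᗮ` to `e'ᗮ`, preserve the volume up to sign, and move `e` by one
unit away from `e'ᗮ`. If the covector `n'` on `e'ᗮ` pulls back to the unit covector `n` on `eᗮ`,
then `L` changes volumes on `eᗮ ∩ nᗮ` by the factor `‖n'‖`. -/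
lemma volumeFactor_eq_norm {V : Type*} [NormedAddCommGroup V] [InnerProductSpace ℝ V]
    [FiniteDimensional ℝ V] (L : V →ₗ[ℝ] V) (W : Submodule ℝ V) {e n e' n' : V}
    (hdet : LinearMap.det L ^ 2 = 1)
    (he : ‖e‖ = 1) (hn : ‖n‖ = 1) (hen : inner ℝ e n = 0)
    (he' : ‖e'‖ = 1) (hen' : inner ℝ e' n' = 0)
    (hW : ∀ x, x ∈ W ↔ inner ℝ e x = 0 ∧ inner ℝ n x = 0)
    (hL : ∀ x, inner ℝ e' (L x) = inner ℝ e x)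
    (hLn : ∀ x, inner ℝ e x = 0 → inner ℝ n' (L x) = inner ℝ n x) :
    volumeFactor L W = ‖n'‖ := by
  have hee : inner ℝ e e = 1 := by rw [real_inner_self_eq_norm_sq, he]; norm_num
  have hnn : inner ℝ n n = 1 := by rw [real_inner_self_eq_norm_sq, hn]; norm_num
  have hee' : inner ℝ e' e' = 1 := by rw [real_inner_self_eq_norm_sq, he']; norm_num
  have hne : inner ℝ n e = 0 := by rw [real_inner_comm, hen]
  have hn'0 : ‖n'‖ ≠ 0 := by
    intro h
    have := hLn n hen
    rw [norm_eq_zero.1 h, inner_zero_left, hnn] at this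
    norm_num at this
  set p : V := ‖n'‖⁻¹ • n' with hp
  have hpp : inner ℝ p p = 1 := by
    rw [hp, real_inner_smul_left, real_inner_smul_right, real_inner_self_eq_norm_sq]
    field_simp
  have hpe : inner ℝ e' p = 0 := by rw [hp, real_inner_smul_right, hen', mul_zero]
  have hpe' : inner ℝ p e' = 0 := by rw [real_inner_comm, hpe]
  have hpL : ∀ x, inner ℝ e x = 0 → inner ℝ p (L x) = ‖n'‖⁻¹ * inner ℝ n x := fun x hx => by
    rw [hp, real_inner_smul_left, hLn x hx]
  -- `M` keeps `L` on `W` but sends `n` and `e` to the unit vectors `p` and `e'`, which are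
  -- orthogonal to each other and to the image of `W`.
  let M : V →ₗ[ℝ] V := L + (innerₗ V n).smulRight (p - L n) + (innerₗ V e).smulRight (e' - L e)
  have hMx : ∀ x, M x = L x + (inner ℝ n x • (p - L n)) + inner ℝ e x • (e' - L e) := fun x => rfl
  -- These maps x ↦ x + f(x) u have determinant 1 + f(u), not necessarily 1. They undo the two
  -- replacements: `N₁ p = L n` and `N₂ e' = L e`.
  let N₁ : V →ₗ[ℝ] V := LinearMap.transvection (innerₗ V p) (L n - p)
  let N₂ : V →ₗ[ℝ] V := LinearMap.transvection (innerₗ V e') (L e - e')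
  have hN₁ : ∀ x, N₁ x = x + inner ℝ p x • (L n - p) := fun x => rfl
  have hN₂ : ∀ x, N₂ x = x + inner ℝ e' x • (L e - e') := fun x => rfl
  have hdecomp : ∀ x, ∃ w, inner ℝ e w = 0 ∧ inner ℝ n w = 0 ∧
      x = w + inner ℝ n x • n + inner ℝ e x • e := fun x =>
    ⟨x - inner ℝ n x • n - inner ℝ e x • e, by
      simp [inner_sub_right, real_inner_smul_right, hen, he], by
      simp [inner_sub_right, real_inner_smul_right, hne, hn], by abel⟩
  have hMw : ∀ w, inner ℝ e w = 0 → inner ℝ n w = 0 → M w = L w := fun w h1 h2 => by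
    rw [hMx, h1, h2]; simp
  have hMn : M n = p := by rw [hMx, hnn, hen]; simp
  have hMe : M e = e' := by rw [hMx, hne, hee]; simp
  have hcomp : L = N₂ ∘ₗ N₁ ∘ₗ M := by
    ext1 x
    obtain ⟨w, hw1, hw2, hx⟩ := hdecomp x
    have h1 : N₂ (N₁ (M w)) = L w := by
      rw [hMw w hw1 hw2, hN₁, hpL w hw1, hw2, mul_zero, zero_smul, add_zero, hN₂, hL, hw1,
        zero_smul, add_zero]
    have h2 : N₂ (N₁ (M n)) = L n := by
      rw [hMn, hN₁, hpp, one_smul, add_sub_cancel, hN₂, hL, hen, zero_smul, add_zero]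
    have h3 : N₂ (N₁ (M e)) = L e := by
      rw [hMe, hN₁, hpe', zero_smul, add_zero, hN₂, hee', one_smul, add_sub_cancel]
    rw [LinearMap.comp_apply, LinearMap.comp_apply, hx]
    simp only [map_add, map_smul, h1, h2, h3]
  have hd₁ : LinearMap.det N₁ = ‖n'‖⁻¹ := by
    rw [LinearMap.transvection.det, innerₗ_apply_apply, inner_sub_right, hpL n hen, hnn, hpp]
    ring
  have hd₂ : LinearMap.det N₂ = 1 := by
    rw [LinearMap.transvection.det, innerₗ_apply_apply, inner_sub_right, hL, hee, hee']
    ring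
  have hdM : |LinearMap.det M| = ‖n'‖ := by
    have h : LinearMap.det L = ‖n'‖⁻¹ * LinearMap.det M := by
      conv_lhs => rw [hcomp]
      rw [LinearMap.det_comp, LinearMap.det_comp, hd₁, hd₂, one_mul]
    have h1 : |LinearMap.det L| = 1 := by
      rw [← sq_eq_sq₀ (abs_nonneg _) zero_le_one, sq_abs, hdet, one_pow]
    rw [h, abs_mul, abs_inv, abs_norm] at h1
    field_simp at h1
    exact h1
  rw [← hdM]
  refine volumeFactor_eq_abs_det L M W (fun x hx => hMw x ((hW x).1 hx).1 ((hW x).1 hx).2) ?_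
  intro x y hy
  obtain ⟨w, hw1, hw2, hy'⟩ := hdecomp y
  -- Vectors of `Wᗮ` are combinations of `n` and `e`, so only the pairings of `M x` with `p` and
  -- `e'` matter.
  have hw : w = 0 := by
    have h1 := Submodule.inner_right_of_mem_orthogonal ((hW w).2 ⟨hw1, hw2⟩) hy
    rw [hy', inner_add_right, inner_add_right, real_inner_smul_right, real_inner_smul_right,
      real_inner_comm n w, real_inner_comm e w, hw1, hw2, mul_zero, mul_zero, add_zero,
      add_zero] at h1
    exact inner_self_eq_zero.1 h1
  have hMp : inner ℝ (M x) p = inner ℝ x n := by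
    obtain ⟨w, hw1, hw2, hx⟩ := hdecomp x
    rw [hx]
    simp only [map_add, map_smul, hMw w hw1 hw2, hMn, hMe, inner_add_left, real_inner_smul_left,
      hpp, hpe, hnn, hen, real_inner_comm p (L w), hpL w hw1, hw2, real_inner_comm n w, mul_zero]
  have hMe'' : inner ℝ (M x) e' = inner ℝ x e := by
    obtain ⟨w, hw1, hw2, hx⟩ := hdecomp x
    rw [hx]
    simp only [map_add, map_smul, hMw w hw1 hw2, hMn, hMe, inner_add_left, real_inner_smul_left,
      hpe', hee', hne, hee, real_inner_comm e' (L w), hL, hw1, real_inner_comm e w, mul_zero]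
  rw [hy', hw]
  simp only [map_add, map_smul, map_zero, hMn, hMe, inner_add_right, real_inner_smul_right,
    inner_zero_right, hMp, hMe'']

/-! ### Linear maps of the phase space that are dispersing -/

@[simp] lemma pt_fst {d : ℕ} (q v : Space d) : (pt q v).fst = q := rfl

@[simp] lemma pt_snd {d : ℕ} (q v : Space d) : (pt q v).snd = v := rfl

lemma phase_ext {d : ℕ} {x y : Phase d} (h1 : x.fst = y.fst) (h2 : x.snd = y.snd) : x = y := by
  rw [WithLp.ext_iff]
  exact Prod.ext h1 h2

/-- The linear map of the phase space with the matrix `[[a, b], [c, e]]`. -/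
def blockMap {d : ℕ} (a b c e : Space d →ₗ[ℝ] Space d) : Phase d →ₗ[ℝ] Phase d where
  toFun x := pt (a x.fst + b x.snd) (c x.fst + e x.snd)
  map_add' x y := phase_ext (by simp; abel) (by simp; abel)
  map_smul' r x := phase_ext (by simp) (by simp)

@[simp] lemma blockMap_fst {d : ℕ} (a b c e : Space d →ₗ[ℝ] Space d) (x : Phase d) :
    (blockMap a b c e x).fst = a x.fst + b x.snd := rfl

@[simp] lemma blockMap_snd {d : ℕ} (a b c e : Space d →ₗ[ℝ] Space d) (x : Phase d) :
    (blockMap a b c e x).snd = c x.fst + e x.snd := rfl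

lemma det_sq_of_comp_self {V : Type*} [AddCommGroup V] [Module ℝ V] {L : V →ₗ[ℝ] V}
    (h : L ∘ₗ L = LinearMap.id) : LinearMap.det L ^ 2 = 1 := by
  rw [sq, ← LinearMap.det_comp, h, LinearMap.det_id]

/-- A linear map that is reversible with respect to an involution `J` preserves volumes. -/
lemma det_sq_of_reversible {V : Type*} [AddCommGroup V] [Module ℝ V] {L J : V →ₗ[ℝ] V}
    (hJ : J ∘ₗ J = LinearMap.id) (h : (J ∘ₗ L) ∘ₗ (J ∘ₗ L) = LinearMap.id) :
    LinearMap.det L ^ 2 = 1 := by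
  have h1 := det_sq_of_comp_self hJ
  have h2 := det_sq_of_comp_self h
  rw [LinearMap.det_comp, mul_pow, h1, one_mul] at h2
  exact h2

/-- `Dispersive L v v' T`: the map `L`, the derivative of the billiard flow along a trajectory of
duration `T` with initial velocity `v` and final velocity `v'`, preserves the volume, the kinetic
energy and, on its level sets, the component along the flow, and transports covectors `(z, w)`
orthogonal to the flow so that `‖w‖` grows linearly and `-⟨z, w⟩ / ‖w‖` does not decrease. -/
structure Dispersive {d : ℕ} (L : Phase d →ₗ[ℝ] Phase d) (v v' : Space d) (T : ℝ) : Prop where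
  det_sq : LinearMap.det L ^ 2 = 1
  norm_eq : ‖v'‖ = ‖v‖
  inner_snd : ∀ x, inner ℝ v' (L x).snd = inner ℝ v x.snd
  inner_fst : ∀ x : Phase d, inner ℝ v x.snd = 0 → inner ℝ v' (L x).fst = inner ℝ v x.fst
  nonneg : 0 ≤ T
  transport : ∀ (z w : Space d) (u : ℝ), inner ℝ v z = 0 → inner ℝ v w = 0 → w ≠ 0 → 0 ≤ u →
    u * ‖w‖ ≤ -inner ℝ z w →
    ∃ z' w' : Space d, inner ℝ v' z' = 0 ∧ inner ℝ v' w' = 0 ∧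
      (∀ x, inner ℝ z' (L x).fst + inner ℝ w' (L x).snd
        = inner ℝ z x.fst + inner ℝ w x.snd) ∧
      u * ‖w'‖ ≤ -inner ℝ z' w' ∧ ‖w‖ + T * u ≤ ‖w'‖

/-- The rate u is the same before and after a step, so the increments of ‖w‖ add up. The growth also
keeps w nonzero, as the second step requires. -/
lemma Dispersive.comp {d : ℕ} {L₁ L₂ : Phase d →ₗ[ℝ] Phase d} {v v₁ v₂ : Space d} {T₁ T₂ : ℝ}
    (h₂ : Dispersive L₂ v₁ v₂ T₂) (h₁ : Dispersive L₁ v v₁ T₁) :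
    Dispersive (L₂ ∘ₗ L₁) v v₂ (T₁ + T₂) where
  det_sq := by rw [LinearMap.det_comp, mul_pow, h₁.det_sq, h₂.det_sq, one_mul]
  norm_eq := h₂.norm_eq.trans h₁.norm_eq
  inner_snd x := by rw [LinearMap.comp_apply, h₂.inner_snd, h₁.inner_snd]
  inner_fst x hx := by
    rw [LinearMap.comp_apply, h₂.inner_fst _ (by rw [h₁.inner_snd, hx]), h₁.inner_fst x hx]
  nonneg := add_nonneg h₁.nonneg h₂.nonneg
  transport z w u hz hw hw0 hu h := by
    obtain ⟨z₁, w₁, hz₁, hw₁, e₁, a₁, b₁⟩ := h₁.transport z w u hz hw hw0 hu h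
    have hw₁0 : w₁ ≠ 0 := norm_pos_iff.1 (by
      have := norm_pos_iff.2 hw0
      have := mul_nonneg h₁.nonneg hu
      linarith)
    obtain ⟨z₂, w₂, hz₂, hw₂, e₂, a₂, b₂⟩ := h₂.transport z₁ w₁ u hz₁ hw₁ hw₁0 hu a₁
    exact ⟨z₂, w₂, hz₂, hw₂, fun x => by rw [LinearMap.comp_apply, e₂, e₁], a₂, by linarith⟩

/-- The derivative of the free flight of duration `s`. -/
def flight {d : ℕ} (s : ℝ) : Phase d →ₗ[ℝ] Phase d :=
  blockMap LinearMap.id (s • LinearMap.id) 0 LinearMap.id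

/-- Reversing the velocity turns the flight into its inverse, hence the determinant. For the
transport, Cauchy–Schwarz gives u ≤ ‖z‖, so the gain s‖z‖² of -Q pays for the increase of u‖w‖,
which is at most s u‖z‖. Pairing w - s z with w gives the growth of ‖w‖. -/
lemma dispersive_flight {d : ℕ} (v : Space d) {s : ℝ} (hs : 0 ≤ s) :
    Dispersive (flight s) v v s where
  det_sq := by
    refine det_sq_of_reversible (J := blockMap LinearMap.id 0 0 (-LinearMap.id)) ?_ ?_
    · ext1 x
      exact phase_ext (by simp) (by simp)
    · ext1 x
      exact phase_ext (by simp [flight]) (by simp [flight])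
  norm_eq := rfl
  inner_snd x := by simp [flight]
  inner_fst x hx := by simp [flight, inner_add_right, real_inner_smul_right, hx]
  nonneg := hs
  transport z w u hz hw hw0 hu h := by
    have hwp := norm_pos_iff.2 hw0
    have hzu : u ≤ ‖z‖ := by
      have h1 := neg_le_of_abs_le (abs_real_inner_le_norm z w)
      exact le_of_mul_le_mul_right (by linarith) hwp
    refine ⟨z, w - s • z, hz, by simp [inner_sub_right, real_inner_smul_right, hz, hw],
      fun x => ?_, ?_, ?_⟩
    · simp only [flight, blockMap_fst, blockMap_snd, LinearMap.id_apply, LinearMap.smul_apply,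
        LinearMap.zero_apply, zero_add, inner_add_right, inner_sub_left, real_inner_smul_left,
        real_inner_smul_right]
      ring
    · have h1 : ‖w - s • z‖ ≤ ‖w‖ + s * ‖z‖ := by
        refine (norm_sub_le _ _).trans ?_
        rw [norm_smul, Real.norm_of_nonneg hs]
      rw [inner_sub_right, real_inner_smul_right, real_inner_self_eq_norm_sq]
      have h2 := mul_le_mul_of_nonneg_left h1 hu
      have h3 := mul_le_mul_of_nonneg_left hzu (mul_nonneg hs (norm_nonneg z))
      nlinarith
    · have h1 := real_inner_le_norm (w - s • z) w
      rw [inner_sub_left, real_inner_smul_left, real_inner_self_eq_norm_sq] at h1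
      have h2 := mul_le_mul_of_nonneg_left h hs
      exact le_of_mul_le_mul_right (by nlinarith) hwp

/-! ### Linear algebra of a single collision. -/

/-- The reflection in the hyperplane orthogonal to `ν`, as a linear map. -/
def reflectₗ {d : ℕ} (ν : Space d) : Space d →ₗ[ℝ] Space d :=
  LinearMap.id - (innerₗ (Space d) ν).smulRight ((2 : ℝ) • ν)

lemma reflectₗ_apply {d : ℕ} (ν v : Space d) : reflectₗ ν v = v - (2 * inner ℝ ν v) • ν := by
  simp [reflectₗ, smul_smul, mul_comm]

lemma reflect_eq {d : ℕ} (ν v : Space d) : reflect ν v = reflectₗ ν v := by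
  rw [reflectₗ_apply, reflect, real_inner_comm]

lemma inner_reflectₗ_left {d : ℕ} (ν x y : Space d) :
    inner ℝ (reflectₗ ν x) y = inner ℝ x (reflectₗ ν y) := by
  simp only [reflectₗ_apply, inner_sub_left, inner_sub_right, real_inner_smul_left,
    real_inner_smul_right, real_inner_comm x ν]
  ring

lemma reflectₗ_reflectₗ {d : ℕ} {ν : Space d} (hν : ‖ν‖ = 1) (x : Space d) :
    reflectₗ ν (reflectₗ ν x) = x := by
  simp only [reflectₗ_apply, inner_sub_right, real_inner_smul_right, real_inner_self_eq_norm_sq, hν]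
  module

lemma norm_reflectₗ {d : ℕ} {ν : Space d} (hν : ‖ν‖ = 1) (x : Space d) :
    ‖reflectₗ ν x‖ = ‖x‖ := by
  have : ‖reflectₗ ν x‖ ^ 2 = ‖x‖ ^ 2 := by
    rw [← real_inner_self_eq_norm_sq, inner_reflectₗ_left, reflectₗ_reflectₗ hν,
      real_inner_self_eq_norm_sq]
  exact (sq_eq_sq₀ (norm_nonneg _) (norm_nonneg _)).1 this

/-- The projection along `v` to the hyperplane orthogonal to `ν`. -/
def slide {d : ℕ} (ν v : Space d) : Space d →ₗ[ℝ] Space d :=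
  LinearMap.id - (innerₗ (Space d) ν).smulRight ((inner ℝ v ν)⁻¹ • v)

lemma slide_apply {d : ℕ} (ν v q : Space d) :
    slide ν v q = q - (inner ℝ ν q / inner ℝ v ν) • v := by
  simp [slide, smul_smul, div_eq_mul_inv]

/-- The dependence of the outgoing velocity on the collision point, where `K` is the derivative of
the unit normal field. -/
def kick {d : ℕ} (K : Space d →ₗ[ℝ] Space d) (ν v : Space d) : Space d →ₗ[ℝ] Space d :=
  (-(2 : ℝ)) • (((innerₗ (Space d) v) ∘ₗ K).smulRight ν + (inner ℝ v ν) • K) ∘ₗ slide ν v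

lemma kick_apply {d : ℕ} (K : Space d →ₗ[ℝ] Space d) (ν v q : Space d) :
    kick K ν v q = -((2 * inner ℝ v (K (slide ν v q))) • ν)
      - (2 * inner ℝ v ν) • K (slide ν v q) := by
  simp [kick]
  module

/-- The derivative of the collision map. -/
def collision {d : ℕ} (K : Space d →ₗ[ℝ] Space d) (ν v : Space d) : Phase d →ₗ[ℝ] Phase d :=
  blockMap (reflectₗ ν) 0 (kick K ν v) (reflectₗ ν)

/-- Up to an isometry the collision is a shear in the velocity, so it preserves volume. With R the
reflection, the covector becomes (R(z - kickᵀ R w), R w). Thus ‖w‖ is kept and -Q gains ⟨R w, kick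
w⟩ = -2⟨v, ν⟩⟨K a, a⟩ with a = `slide ν v w`. This is nonnegative because the velocity is incoming
and a is tangent to the boundary. -/
lemma dispersive_collision {d : ℕ} {K : Space d →ₗ[ℝ] Space d} {ν v : Space d} (hν : ‖ν‖ = 1)
    (hv : inner ℝ v ν < 0) (hKν : ∀ u, inner ℝ ν (K u) = 0)
    (hK : ∀ u, inner ℝ u ν = 0 → 0 ≤ inner ℝ (K u) u) :
    Dispersive (collision K ν v) v (reflectₗ ν v) 0 where
  det_sq := by
    have h1 : collision K ν v =
        blockMap LinearMap.id 0 (kick K ν v ∘ₗ reflectₗ ν) LinearMap.id ∘ₗ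
          blockMap (reflectₗ ν) 0 0 (reflectₗ ν) := by
      ext1 x
      exact phase_ext (by simp [collision])
        (by simp [collision, reflectₗ_reflectₗ hν])
    have h2 : LinearMap.det (blockMap (reflectₗ ν) 0 0 (reflectₗ ν)) ^ 2 = 1 := by
      refine det_sq_of_comp_self ?_
      ext1 x
      exact phase_ext (by simp [reflectₗ_reflectₗ hν]) (by simp [reflectₗ_reflectₗ hν])
    have h3 : LinearMap.det (blockMap LinearMap.id 0 (kick K ν v ∘ₗ reflectₗ ν) LinearMap.id) ^ 2
        = 1 := by
      refine det_sq_of_reversible (J := blockMap LinearMap.id 0 0 (-LinearMap.id)) ?_ ?_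
      · ext1 x
        exact phase_ext (by simp) (by simp)
      · ext1 x
        exact phase_ext (by simp) (by simp)
    rw [h1, LinearMap.det_comp, mul_pow, h2, h3, one_mul]
  norm_eq := norm_reflectₗ hν v
  inner_snd x := by
    simp only [collision, blockMap_snd]
    rw [inner_add_right, inner_reflectₗ_left, inner_reflectₗ_left, reflectₗ_reflectₗ hν,
      kick_apply, reflectₗ_apply]
    simp only [inner_sub_right, inner_neg_right, real_inner_smul_right, hKν,
      real_inner_self_eq_norm_sq, hν]
    ring
  inner_fst x hx := by
    simp only [collision, blockMap_fst, LinearMap.zero_apply, add_zero]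
    rw [inner_reflectₗ_left, reflectₗ_reflectₗ hν]
  nonneg := le_rfl
  transport z w u hz hw hw0 hu h := by
    have hν2 : inner ℝ ν ν = 1 := by rw [real_inner_self_eq_norm_sq, hν]; norm_num
    -- A displacement along v does not move the collision point, so it causes no kick. This keeps
    -- the new z orthogonal to the outgoing velocity.
    have hslide : slide ν v v = 0 := by
      rw [slide_apply, real_inner_comm, div_self hv.ne, one_smul, sub_self]
    have hkick : kick K ν v v = 0 := by rw [kick_apply, hslide]; simp
    have hpos : 0 ≤ inner ℝ (reflectₗ ν w) (kick K ν v w) := by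
      have h1 : inner ℝ (slide ν v w) ν = 0 := by
        rw [slide_apply, inner_sub_left, real_inner_smul_left, div_mul_cancel₀ _ hv.ne,
          real_inner_comm, sub_self]
      have h2 := hK _ h1
      have h3 : inner ℝ (reflectₗ ν w) (kick K ν v w)
          = -2 * inner ℝ v ν * inner ℝ (K (slide ν v w)) (slide ν v w) := by
        generalize hk : K (slide ν v w) = k
        have hk0 : inner ℝ ν k = 0 := by rw [← hk, hKν]
        rw [kick_apply, hk, slide_apply, reflectₗ_apply]
        simp only [real_inner_comm _ k,
          inner_sub_left, inner_sub_right, inner_neg_right, real_inner_smul_right,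
          real_inner_smul_left, hk0, hν2, real_inner_comm w ν]
        have := hv.ne
        field_simp
        ring
      rw [h3]
      exact mul_nonneg (by linarith) h2
    refine ⟨reflectₗ ν (z - LinearMap.adjoint (kick K ν v) (reflectₗ ν w)), reflectₗ ν w,
      ?_, ?_, fun x => ?_, ?_, ?_⟩
    · rw [inner_reflectₗ_left, reflectₗ_reflectₗ hν, inner_sub_right, hz,
        LinearMap.adjoint_inner_right, hkick, inner_zero_left, sub_zero]
    · rw [inner_reflectₗ_left, reflectₗ_reflectₗ hν, hw]
    · simp only [collision, blockMap_fst, blockMap_snd, LinearMap.zero_apply, add_zero]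
      rw [inner_reflectₗ_left, reflectₗ_reflectₗ hν, inner_sub_left,
        LinearMap.adjoint_inner_left, inner_add_right, inner_reflectₗ_left ν w (reflectₗ ν x.snd),
        reflectₗ_reflectₗ hν]
      ring
    · rw [inner_reflectₗ_left, reflectₗ_reflectₗ hν, inner_sub_left,
        LinearMap.adjoint_inner_left, norm_reflectₗ hν]
      linarith
    · rw [norm_reflectₗ hν]
      linarith

/-! ### Regular boundary points -/

section Boundary

variable {d : ℕ} {D : Set (Space d)} {q : Space d} {F : Space d → ℝ}

lemma continuousAt_gradient (hF : IsDefiningFunction D q F) : ContinuousAt (gradient F) q := by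
  have h := (hF.contDiffAt.fderiv_right (m := 2) (by norm_num)).continuousAt
  exact (InnerProductSpace.toDual ℝ (Space d)).symm.continuous.continuousAt.comp h

lemma inner_gradient_eq_fderiv (y u : Space d) : inner ℝ (gradient F y) u = fderiv ℝ F y u := by
  simp [gradient]

/-- Perturbed trajectories hit the boundary at nearby points, where the same F has to serve. -/
lemma IsDefiningFunction.eventually (hF : IsDefiningFunction D q F) :
    ∀ᶠ y in 𝓝 q, F y = 0 → IsDefiningFunction D y F := by
  filter_upwards [hF.contDiffAt.eventually (by simp),
    (continuousAt_gradient hF).eventually_ne hF.gradient_ne_zero,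
    hF.mem_iff.eventually_nhds] with y h1 h2 h3 h0
  exact ⟨h0, h1, h2, h3⟩

lemma norm_unitNormal {y : Space d} (h : gradient F y ≠ 0) : ‖unitNormal F y‖ = 1 := by
  simp [unitNormal, norm_smul, norm_ne_zero_iff.2 h]

lemma gradient_eq_smul_unitNormal {y : Space d} (h : gradient F y ≠ 0) :
    gradient F y = ‖gradient F y‖ • unitNormal F y := by
  simp [unitNormal, smul_smul, norm_ne_zero_iff.2 h]

lemma differentiableAt_unitNormal (hF : IsDefiningFunction D q F) :
    DifferentiableAt ℝ (unitNormal F) q := by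
  have h1 : DifferentiableAt ℝ (fderiv ℝ F) q :=
    (hF.contDiffAt.fderiv_right (m := 2) (by norm_num)).differentiableAt (by norm_num)
  have h2 : DifferentiableAt ℝ (gradient F) q :=
    (InnerProductSpace.toDual ℝ (Space d)).symm.toContinuousLinearEquiv.differentiableAt.comp q h1
  exact ((h2.norm ℝ hF.gradient_ne_zero).inv (norm_ne_zero_iff.2 hF.gradient_ne_zero)).smul h2

/-- Differentiation of ‖ν‖² = 1. It supplies `hKν` in `dispersive_collision`. -/
lemma inner_unitNormal_fderiv (hF : IsDefiningFunction D q F) (u : Space d) :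
    inner ℝ (unitNormal F q) (fderiv ℝ (unitNormal F) q u) = 0 := by
  have h1 := (differentiableAt_unitNormal hF).hasFDerivAt
  have h2 := h1.inner ℝ h1
  have h3 : (fun y => inner ℝ (unitNormal F y) (unitNormal F y)) =ᶠ[𝓝 q] fun _ => (1 : ℝ) := by
    filter_upwards [(continuousAt_gradient hF).eventually_ne hF.gradient_ne_zero] with y hy
    rw [real_inner_self_eq_norm_sq, norm_unitNormal hy, one_pow]
  have h4 := (h2.congr_of_eventuallyEq h3.symm).unique (hasFDerivAt_const (1 : ℝ) q)
  have h5 := DFunLike.congr_fun h4 u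
  simpa [real_inner_comm] using h5

/-- Rays that start on the boundary near `q`, with directions close to a direction pointing into
the domain, run in the domain for a uniform time. -/
lemma exists_ray_mem (hF : IsDefiningFunction D q F) {u : Space d}
    (hu : 0 < inner ℝ (unitNormal F q) u) :
    ∃ δ : ℝ, 0 < δ ∧ ∀ᶠ x in 𝓝 (pt q u), F x.fst = 0 → ∀ s ∈ Ioc 0 δ, x.fst + s • x.snd ∈ D := by
  have hgu : 0 < inner ℝ (gradient F q) u := by
    rw [gradient_eq_smul_unitNormal hF.gradient_ne_zero, real_inner_smul_left]
    exact mul_pos (norm_pos_iff.2 hF.gradient_ne_zero) hu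
  have hgood : ∀ᶠ z in 𝓝 (q, u), (z.1 ∈ D ↔ 0 < F z.1) ∧ DifferentiableAt ℝ F z.1 ∧
      0 < inner ℝ (gradient F z.1) z.2 := by
    have hfst : Tendsto Prod.fst (𝓝 (q, u)) (𝓝 q) := continuous_fst.tendsto (q, u)
    have h3 : ContinuousAt (fun z : Space d × Space d => inner ℝ (gradient F z.1) z.2) (q, u) :=
      ContinuousAt.inner ((continuousAt_gradient hF).comp_of_eq continuousAt_fst rfl)
        continuousAt_snd
    have h4 : ∀ᶠ y in 𝓝 q, DifferentiableAt ℝ F y :=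
      (hF.contDiffAt.eventually (by simp)).mono fun y hy => hy.differentiableAt (by norm_num)
    exact (hfst.eventually hF.mem_iff).and
      ((hfst.eventually h4).and (h3.eventually (lt_mem_nhds hgu)))
  have hcont : Continuous fun p : Phase d × ℝ => (p.1.fst + p.2 • p.1.snd, p.1.snd) := by fun_prop
  have ht := hcont.tendsto (pt q u, 0)
  simp only [pt_fst, pt_snd, zero_smul, add_zero] at ht
  replace ht := ht.eventually hgood
  -- A product neighbourhood separates the phase point from the time, which makes δ uniform. Within
  -- it F increases along each ray, starting from 0.
  rw [nhds_prod_eq] at ht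
  obtain ⟨pa, hpa, pb, hpb, hab⟩ := eventually_prod_iff.1 ht
  obtain ⟨δ, hδ, hball⟩ := Metric.eventually_nhds_iff.1 hpb
  refine ⟨δ / 2, by positivity, hpa.mono fun x hx h0 s hs => ?_⟩
  have hg : ∀ r ∈ Icc 0 s, (x.fst + r • x.snd ∈ D ↔ 0 < F (x.fst + r • x.snd)) ∧
      DifferentiableAt ℝ F (x.fst + r • x.snd) ∧
      0 < inner ℝ (gradient F (x.fst + r • x.snd)) x.snd := by
    intro r hr
    refine hab hx (hball ?_)
    rw [Real.dist_eq, sub_zero, abs_of_nonneg hr.1]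
    linarith [hr.2, hs.2]
  have hder : ∀ r ∈ Icc 0 s, HasDerivAt (fun r : ℝ => F (x.fst + r • x.snd))
      (inner ℝ (gradient F (x.fst + r • x.snd)) x.snd) r := by
    intro r hr
    have hl : HasDerivAt (fun s : ℝ => x.fst + s • x.snd) x.snd r := by
      simpa using ((hasDerivAt_id r).smul_const x.snd).const_add x.fst
    rw [inner_gradient_eq_fderiv]
    exact (hg r hr).2.1.hasFDerivAt.comp_hasDerivAt r hl
  have hmono : StrictMonoOn (fun r : ℝ => F (x.fst + r • x.snd)) (Icc 0 s) := by
    refine strictMonoOn_of_deriv_pos (convex_Icc 0 s)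
      (fun r hr => (hder r hr).continuousAt.continuousWithinAt) fun r hr => ?_
    have hr' := interior_subset hr
    rw [(hder r hr').deriv]
    exact (hg r hr').2.2
  have hlt := hmono (left_mem_Icc.2 hs.1.le) (right_mem_Icc.2 hs.1.le) hs.1
  simp only [zero_smul, add_zero, h0] at hlt
  exact (hg s (right_mem_Icc.2 hs.1.le)).1.2 hlt

/-- The collision time is a differentiable function of the phase point. -/
lemma exists_collisionTime {v : Space d} {a : ℝ} (hF : IsDefiningFunction D (q + a • v) F)
    (hv : inner ℝ v (unitNormal F (q + a • v)) < 0) :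
    ∃ (τ : Phase d → ℝ) (τ' : Phase d →L[ℝ] ℝ), HasFDerivAt τ τ' (pt q v) ∧ τ (pt q v) = a ∧
      ∀ᶠ x in 𝓝 (pt q v), F (x.fst + τ x • x.snd) = 0 := by
  let f : Phase d × ℝ → ℝ := fun p => F (p.1.fst + p.2 • p.1.snd)
  have hf : ContDiffAt ℝ 3 f (pt q v, a) := by
    refine ContDiffAt.comp (g := F) (pt q v, a) hF.contDiffAt ?_
    exact (((WithLp.fstL 2 ℝ (Space d) (Space d)).contDiff (n := 3)).comp
      contDiff_fst).contDiffAt.add (contDiffAt_snd.smul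
        (((WithLp.sndL 2 ℝ (Space d) (Space d)).contDiff (n := 3)).comp contDiff_fst).contDiffAt)
  have hs : HasStrictFDerivAt f (fderiv ℝ f (pt q v, a)) (pt q v, a) :=
    hf.hasStrictFDerivAt (by norm_num)
  -- The time derivative of f is nonzero because the collision is not tangential, so f = 0 can be
  -- solved for the time.
  have hpart : fderiv ℝ f (pt q v, a) (0, 1) = inner ℝ (gradient F (q + a • v)) v := by
    have h1 := (hasDerivAt_const (𝕜 := ℝ) a (pt q v)).prodMk (hasDerivAt_id a)
    have h2 := hs.hasFDerivAt.comp_hasDerivAt a h1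
    have hl : HasDerivAt (fun s : ℝ => q + s • v) v a := by
      simpa using ((hasDerivAt_id a).smul_const v).const_add q
    have h3 := (hF.contDiffAt.differentiableAt (by norm_num)).hasFDerivAt.comp_hasDerivAt a hl
    rw [inner_gradient_eq_fderiv]
    exact h2.unique h3
  have hne : fderiv ℝ f (pt q v, a) (0, 1) ≠ 0 := by
    rw [hpart, gradient_eq_smul_unitNormal hF.gradient_ne_zero, real_inner_smul_left,
      real_inner_comm]
    exact (mul_neg_of_pos_of_neg (norm_pos_iff.2 hF.gradient_ne_zero) hv).ne
  have hinv : (fderiv ℝ f (pt q v, a) ∘L .inr ℝ (Phase d) ℝ).IsInvertible := by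
    refine ⟨ContinuousLinearEquiv.unitsEquivAut ℝ (Units.mk0 _ hne), ?_⟩
    ext
    simp
  refine ⟨hs.implicitFunctionOfProdDomain hinv, _,
    (hs.hasStrictFDerivAt_implicitFunctionOfProdDomain hinv).hasFDerivAt,
    (hs.eventually_apply_eq_iff_implicitFunctionOfProdDomain hinv).self_of_nhds.1 rfl, ?_⟩
  filter_upwards [hs.eventually_apply_implicitFunctionOfProdDomain hinv] with x hx
  exact hx.trans hF.zero

end Boundary

/-! ### Differentiability of the billiard flow -/

section Flow

variable {d : ℕ} {D : Set (Space d)}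

/-- `Reach` breaks a trajectory only at collisions, so a flight put in front must be merged with the
first flight of what follows. -/
lemma Reach.prepend_free {q v : Space d} {σ T : ℝ} {y : Phase d}
    (h : Reach D T (pt (q + σ • v) v) y) (hσ : 0 ≤ σ) (hfree : ∀ s ∈ Ioc 0 σ, q + s • v ∈ D) :
    Reach D (σ + T) (pt q v) y := by
  generalize hx : pt (q + σ • v) v = x at h
  cases h with
  | free q' v' _ ht hfree' =>
    obtain ⟨rfl, rfl⟩ := pt_inj hx
    rw [add_assoc, ← add_smul]
    refine Reach.free q v _ (add_nonneg hσ ht) fun s hs => ?_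
    rcases le_or_gt s σ with h | h
    · exact hfree s ⟨hs.1, h⟩
    · have := hfree' (s - σ) ⟨by linarith, by linarith [hs.2]⟩
      rwa [add_assoc, ← add_smul, add_sub_cancel] at this
  | collide q' v' ν τ t _ hτ hfree' hν htrans hrest =>
    obtain ⟨rfl, rfl⟩ := pt_inj hx
    rw [add_assoc, ← add_smul] at hν hrest
    rw [← add_assoc]
    rcases hσ.eq_or_lt with rfl | hσ0
    · simp only [zero_add, zero_smul, add_zero] at *
      exact Reach.collide q v ν τ t y hτ hfree' hν htrans hrest
    refine Reach.collide q v ν (σ + τ) t y (by linarith) (fun s hs => ?_) hν htrans hrest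
    rcases le_or_gt s σ with h | h
    · exact hfree s ⟨hs.1, h⟩
    · have := hfree' (s - σ) ⟨by linarith, by linarith [hs.2]⟩
      rwa [add_assoc, ← add_smul, add_sub_cancel] at this

lemma eventually_segment_mem (hD : IsOpen D) {q v : Space d} {a : ℝ}
    (h : ∀ s ∈ Icc 0 a, q + s • v ∈ D) :
    ∀ᶠ x in 𝓝 (pt q v), ∀ s ∈ Icc 0 a, x.fst + s • x.snd ∈ D := by
  refine isCompact_Icc.eventually_forall_of_forall_eventually fun s hs => ?_
  have hcont : Continuous fun p : Phase d × ℝ => p.1.fst + p.2 • p.1.snd := by fun_prop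
  exact (hcont.tendsto (pt q v, s)).eventually (hD.mem_nhds (h s hs))

lemma pt_eta (x : Phase d) : pt x.fst x.snd = x := rfl

lemma continuousSMul_of_normedSpace {V : Type*} [NormedAddCommGroup V] [NormedSpace ℝ V] :
    ContinuousSMul ℝ V := inferInstance

/-- A shortcut instance: its general derivation unfolds the topology of `Phase d`. -/
instance : ContinuousSMul ℝ (Phase d) := continuousSMul_of_normedSpace

/-- A linear map of a finite-dimensional normed space, as a continuous linear map. -/
def toCLM {V : Type*} [NormedAddCommGroup V] [NormedSpace ℝ V] [FiniteDimensional ℝ V]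
    (L : V →ₗ[ℝ] V) : V →L[ℝ] V := L.toContinuousLinearMap

@[simp] lemma toCLM_apply {V : Type*} [NormedAddCommGroup V] [NormedSpace ℝ V]
    [FiniteDimensional ℝ V] (L : V →ₗ[ℝ] V) (x : V) : toCLM L x = L x := rfl

lemma hasFDerivAt_pt {V : Type*} [NormedAddCommGroup V] [NormedSpace ℝ V] {f g : V → Space d}
    {f' g' : V →L[ℝ] Space d} {x : V} (hf : HasFDerivAt f f' x) (hg : HasFDerivAt g g' x)
    (L : V →L[ℝ] Phase d) (hL : ∀ y, L y = pt (f' y) (g' y)) :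
    HasFDerivAt (fun y => pt (f y) (g y)) L x := by
  have h := (WithLp.prodContinuousLinearEquiv 2 ℝ (Space d) (Space d)).symm.hasFDerivAt.comp x
    (hf.prodMk hg)
  refine h.congr_fderiv ?_
  ext1 y
  rw [hL]
  rfl

lemma hasFDerivAt_fst (x : Phase d) :
    HasFDerivAt (fun y : Phase d => y.fst) (WithLp.fstL 2 ℝ (Space d) (Space d)) x :=
  (WithLp.fstL 2 ℝ (Space d) (Space d)).hasFDerivAt

lemma hasFDerivAt_snd (x : Phase d) :
    HasFDerivAt (fun y : Phase d => y.snd) (WithLp.sndL 2 ℝ (Space d) (Space d)) x :=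
  (WithLp.sndL 2 ℝ (Space d) (Space d)).hasFDerivAt

lemma hasFDerivAt_flight (s : ℝ) (x : Phase d) :
    HasFDerivAt (fun y : Phase d => pt (y.fst + s • y.snd) y.snd)
      (toCLM (flight s)) x := by
  refine hasFDerivAt_pt ((hasFDerivAt_fst x).add ((hasFDerivAt_snd x).const_smul s))
    (hasFDerivAt_snd x) _ fun y => ?_
  exact phase_ext (by simp [flight]) (by simp [flight])

/-- Near a trajectory with one regular collision at time `a`, the phase point at a fixed time
`a + b` after the collision is a differentiable function of the initial point. -/
lemma hasFDerivAt_collisionStep {q v : Space d} {a b : ℝ} {F : Space d → ℝ}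
    (hF : IsDefiningFunction D (q + a • v) F)
    (hv : inner ℝ v (unitNormal F (q + a • v)) < 0)
    {τ : Phase d → ℝ} {τ' : Phase d →L[ℝ] ℝ} (hτ : HasFDerivAt τ τ' (pt q v))
    (hτa : τ (pt q v) = a) (hτF : ∀ᶠ x in 𝓝 (pt q v), F (x.fst + τ x • x.snd) = 0) :
    HasFDerivAt (fun x : Phase d => pt (x.fst + τ x • x.snd
        + (a + b - τ x) • reflect (unitNormal F (x.fst + τ x • x.snd)) x.snd)
        (reflect (unitNormal F (x.fst + τ x • x.snd)) x.snd))
      (toCLM (flight b ∘ₗ collision (fderiv ℝ (unitNormal F) (q + a • v)) (unitNormal F (q + a • v)) v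
        ∘ₗ flight a)) (pt q v) := by
  have hc := (hasFDerivAt_fst (pt q v)).add (hτ.smul (hasFDerivAt_snd (pt q v)))
  set c' := WithLp.fstL 2 ℝ (Space d) (Space d) + (τ (pt q v) • WithLp.sndL 2 ℝ (Space d) (Space d)
    + τ'.smulRight (pt q v).snd) with hc'
  have hc'x : ∀ x : Phase d, c' x = x.fst + a • x.snd + τ' x • v := fun x => by
    simp [hc', hτa, add_assoc]
  replace hc : HasFDerivAt (fun x : Phase d => x.fst + τ x • x.snd) c' (pt q v) := hc
  have hcq : (pt q v).fst + τ (pt q v) • (pt q v).snd = q + a • v := by rw [hτa]; rfl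
  set ν := unitNormal F (q + a • v) with hν
  set K := fderiv ℝ (unitNormal F) (q + a • v) with hK
  -- The perturbed collision points stay on F = 0, so they move tangentially to the boundary. This
  -- determines `τ'`.
  have hconstr : ∀ x, inner ℝ ν (c' x) = 0 := by
    intro x
    have h1 : HasFDerivAt F (fderiv ℝ F (q + a • v)) ((pt q v).fst + τ (pt q v) • (pt q v).snd) := by
      rw [hcq]; exact (hF.contDiffAt.differentiableAt (by norm_num)).hasFDerivAt
    have h2 := (h1.comp (pt q v) hc).congr_of_eventuallyEq
      (f₁ := fun _ => (0 : ℝ)) (hτF.mono fun x hx => hx.symm)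
    have h3 := DFunLike.congr_fun (h2.unique (hasFDerivAt_const (0 : ℝ) (pt q v))) x
    have h4 : inner ℝ (gradient F (q + a • v)) (c' x) = 0 := by
      rw [inner_gradient_eq_fderiv]; exact h3
    rw [hν, unitNormal, real_inner_smul_left, h4, mul_zero]
  have hτx : ∀ x, τ' x = -(inner ℝ ν (x.fst + a • x.snd) / inner ℝ v ν) := by
    intro x
    have h := hconstr x
    rw [hc'x, inner_add_right, real_inner_smul_right, real_inner_comm v ν] at h
    rw [← neg_div, eq_div_iff hv.ne]
    linarith
  have hslide : ∀ x, c' x = slide ν v (x.fst + a • x.snd) := fun x => by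
    rw [hc'x, hτx, slide_apply, neg_smul, sub_eq_add_neg]
  have hN : HasFDerivAt (fun x : Phase d => unitNormal F (x.fst + τ x • x.snd)) (K ∘L c')
      (pt q v) := by
    have h1 : HasFDerivAt (unitNormal F) K ((pt q v).fst + τ (pt q v) • (pt q v).snd) := by
      rw [hcq]; exact (differentiableAt_unitNormal hF).hasFDerivAt
    exact h1.comp (pt q v) hc
  have hr := (hasFDerivAt_snd (pt q v)).sub
    ((((hasFDerivAt_snd (pt q v)).inner ℝ hN).const_mul 2).smul hN)
  set r' := WithLp.sndL 2 ℝ (Space d) (Space d) - _ with hr'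
  have hr'x : ∀ x : Phase d, r' x = kick K ν v (x.fst + a • x.snd) + reflectₗ ν x.snd := by
    intro x
    rw [hr', hcq, ← hν]
    simp only [sub_apply, add_apply,
      smul_apply, ContinuousLinearMap.smulRight_apply,
      ContinuousLinearMap.comp_apply, ContinuousLinearMap.prod_apply, fderivInnerCLM_apply,
      WithLp.sndL_apply, pt_snd, kick_apply, reflectₗ_apply, ContinuousLinearMap.coe_coe, ← hslide,
      real_inner_comm _ x.snd, smul_eq_mul]
    module
  replace hr : HasFDerivAt (fun x : Phase d => reflect (unitNormal F (x.fst + τ x • x.snd)) x.snd)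
    r' (pt q v) := hr
  have hp := hc.add ((hτ.const_sub (a + b)).smul hr)
  refine hasFDerivAt_pt hp hr _ fun x => phase_ext ?_ ?_
  · simp only [toCLM_apply, LinearMap.comp_apply, flight, collision,
      blockMap_fst, blockMap_snd, pt_fst, pt_snd, LinearMap.id_apply, LinearMap.smul_apply,
      LinearMap.zero_apply, zero_add, add_zero, add_apply,
      smul_apply, ContinuousLinearMap.smulRight_apply, hτa,
      neg_apply, hr'x, reflect_eq, add_sub_cancel_left]
    -- A delay of the collision lengthens the incoming flight and shortens the outgoing one equally.
    -- As v and its reflection differ by a multiple of ν, the net effect is to reflect the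
    -- displacement at time a.
    have h1 : c' x + (-τ' x) • reflectₗ ν v = reflectₗ ν (x.fst + a • x.snd) := by
      rw [hslide, slide_apply, hτx, reflectₗ_apply, reflectₗ_apply, real_inner_comm v ν]
      have := hv.ne
      match_scalars <;> field_simp
      ring
    rw [← h1]
    abel
  · simp only [toCLM_apply, LinearMap.comp_apply, flight, collision,
      blockMap_fst, blockMap_snd, pt_fst, pt_snd, LinearMap.id_apply, LinearMap.smul_apply,
      LinearMap.zero_apply, zero_add, hr'x]

/-- A flight of duration `a` inside the domain that ends with a regular collision can be perturbed:
all nearby trajectories collide as well, and the phase point shortly after the collision is a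
differentiable function of the initial point. -/
lemma exists_collisionStep (hD : IsOpen D) {q v ν : Space d} {a : ℝ} (ha : 0 < a)
    (hfree : ∀ s ∈ Ico 0 a, q + s • v ∈ D) (hν : IsInwardNormal D (q + a • v) ν)
    (hv : inner ℝ v ν < 0)
    (hdisp : ∀ F, IsDefiningFunction D (q + a • v) F →
      ∀ u : Space d, inner ℝ u (unitNormal F (q + a • v)) = 0 →
        0 ≤ inner ℝ (fderiv ℝ (unitNormal F) (q + a • v) u) u) :
    ∃ δ : ℝ, 0 < δ ∧ (∀ s ∈ Ioc 0 δ, q + a • v + s • reflect ν v ∈ D) ∧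
      ∀ b, 0 < b → b ≤ δ → ∃ (g : Phase d → Phase d) (L : Phase d →ₗ[ℝ] Phase d),
        g (pt q v) = pt (q + a • v + b • reflect ν v) (reflect ν v) ∧
        HasFDerivAt g (toCLM L) (pt q v) ∧
        Dispersive L v (reflect ν v) (a + b) ∧
        ∀ᶠ x in 𝓝 (pt q v), ∀ T y, Reach D T (g x) y → Reach D (a + b + T) x y := by
  obtain ⟨F, hF, rfl⟩ := hν
  set ν := unitNormal F (q + a • v) with hν
  have hν1 : ‖ν‖ = 1 := norm_unitNormal hF.gradient_ne_zero
  obtain ⟨τ, τ', hτ, hτa, hτF⟩ := exists_collisionTime hF hv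
  have hcq : (pt q v).fst + τ (pt q v) • (pt q v).snd = q + a • v := by rw [hτa]; rfl
  have hc : Tendsto (fun x : Phase d => x.fst + τ x • x.snd) (𝓝 (pt q v)) (𝓝 (q + a • v)) := by
    have h : ContinuousAt (fun x : Phase d => x.fst + τ x • x.snd) (pt q v) :=
      (hasFDerivAt_fst (pt q v)).continuousAt.add
        (hτ.continuousAt.smul (hasFDerivAt_snd (pt q v)).continuousAt)
    rw [ContinuousAt, hcq] at h
    exact h
  have hs : Tendsto (fun x : Phase d => x.snd) (𝓝 (pt q v)) (𝓝 v) :=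
    (hasFDerivAt_snd (pt q v)).continuousAt
  have hN : Tendsto (fun x : Phase d => unitNormal F (x.fst + τ x • x.snd)) (𝓝 (pt q v)) (𝓝 ν) :=
    (differentiableAt_unitNormal hF).continuousAt.tendsto.comp hc
  have hsN := hs.inner hN (𝕜 := ℝ)
  have hr : Tendsto (fun x : Phase d => reflect (unitNormal F (x.fst + τ x • x.snd)) x.snd)
      (𝓝 (pt q v)) (𝓝 (reflect ν v)) := hs.sub ((hsN.const_mul 2).smul hN)
  have hpt : ∀ {f g : Phase d → Space d} {p u : Space d}, Tendsto f (𝓝 (pt q v)) (𝓝 p) →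
      Tendsto g (𝓝 (pt q v)) (𝓝 u) → Tendsto (fun x => pt (f x) (g x)) (𝓝 (pt q v)) (𝓝 (pt p u)) :=
    fun hf hg => ((WithLp.prod_continuous_toLp 2 (Space d) (Space d)).tendsto _).comp
      (hf.prodMk_nhds hg)
  obtain ⟨δ₁, hδ₁, hout⟩ := exists_ray_mem (u := reflect ν v) hF (by
    rw [reflect_eq, reflectₗ_apply, inner_sub_right, real_inner_smul_right,
      real_inner_self_eq_norm_sq, hν1, real_inner_comm]
    linarith)
  -- The reversed incoming ray controls the end of the incoming flight, which compactness cannot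
  -- reach because the collision point is not in D.
  obtain ⟨δ₂, hδ₂, hin⟩ := exists_ray_mem (u := -v) hF (by
    rw [inner_neg_right, real_inner_comm]
    linarith)
  set η := min δ₁ (min δ₂ a) with hη
  have hη0 : 0 < η := lt_min hδ₁ (lt_min hδ₂ ha)
  have hη1 : η ≤ δ₁ := min_le_left _ _
  have hη2 : η ≤ δ₂ := (min_le_right _ _).trans (min_le_left _ _)
  have hη3 : η ≤ a := (min_le_right _ _).trans (min_le_right _ _)
  refine ⟨η / 2, by positivity, fun s hs => ?_, fun b hb hbη => ⟨_, _, ?_,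
    hasFDerivAt_collisionStep (b := b) hF hv hτ hτa hτF, ?_, ?_⟩⟩
  · exact hout.self_of_nhds hF.zero s ⟨hs.1, by linarith [hs.2]⟩
  · rw [hcq, hτa, add_sub_cancel_left]
    rfl
  · have h1 := dispersive_collision (K := (fderiv ℝ (unitNormal F) (q + a • v)).toLinearMap) hν1 hv
      (inner_unitNormal_fderiv hF) (hdisp F hF)
    have h2 := ((dispersive_flight _ hb.le).comp (h1.comp (dispersive_flight v ha.le)))
    rw [← reflect_eq, add_zero] at h2
    exact h2
  · have hseg : ∀ᶠ x in 𝓝 (pt q v), ∀ s ∈ Icc 0 (a - η / 2), x.fst + s • x.snd ∈ D :=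
      eventually_segment_mem hD fun s hs => hfree s ⟨hs.1, by linarith [hs.2]⟩
    -- Since b ≤ η / 2, this puts the collision before time a + b and leaves at most 3η/4 to each of
    -- the two ray estimates.
    have hτ1 : ∀ᶠ x in 𝓝 (pt q v), |τ x - a| < b / 2 := by
      have h := hτ.continuousAt.tendsto
      rw [hτa] at h
      exact (Metric.tendsto_nhds.1 h (b / 2) (by positivity)).mono fun x hx => by
        rwa [Real.dist_eq] at hx
    filter_upwards [hseg, hτ1, hτF, hc.eventually hF.eventually, hsN.eventually (gt_mem_nhds hv),
      (hpt hc hr).eventually hout, (hpt hc hs.neg).eventually hin]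
      with x hx1 hx2 hx3 hx4 hx5 hx6 hx7 T y hy
    have hτl := neg_lt_of_abs_lt hx2
    have hτu := lt_of_abs_lt hx2
    have hrest : Reach D (a + b - τ x + T) (pt (x.fst + τ x • x.snd)
        (reflect (unitNormal F (x.fst + τ x • x.snd)) x.snd)) y := by
      refine Reach.prepend_free hy (by linarith) fun s hs => ?_
      exact hx6 hx3 s ⟨hs.1, by linarith [hs.2]⟩
    have hcol := Reach.collide x.fst x.snd _ (τ x) _ y (by linarith) (fun s hs => ?_)
      ⟨F, hx4 hx3, rfl⟩ hx5 hrest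
    · rw [show a + b + T = τ x + (a + b - τ x + T) by ring]
      exact hcol
    · rcases le_or_gt s (a - η / 2) with h | h
      · exact hx1 s ⟨hs.1.le, h⟩
      · have h1 := hx7 hx3 (τ x - s) ⟨by linarith [hs.2], by linarith⟩
        have e : x.fst + τ x • x.snd + (τ x - s) • -x.snd = x.fst + s • x.snd := by module
        rw [pt_fst, pt_snd, e] at h1
        exact h1

/-- Along a regular trajectory that starts and ends in a semi-dispersing domain, the billiard flow
is differentiable, and its derivative is dispersive. -/
theorem Reach.exists_hasFDerivAt (hD : IsOpen D)
    (hdisp : ∀ q F, IsDefiningFunction D q F → ∀ u : Space d, inner ℝ u (unitNormal F q) = 0 →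
      0 ≤ inner ℝ (fderiv ℝ (unitNormal F) q u) u)
    {T : ℝ} {x y : Phase d} (h : Reach D T x y) (hy : y.fst ∈ D) :
    ∀ σ, 0 ≤ σ → σ ≤ T → (∀ s ∈ Ioc 0 σ, x.fst + s • x.snd ∈ D) → x.fst + σ • x.snd ∈ D →
      ∃ L : Phase d →ₗ[ℝ] Phase d,
        HasFDerivAt (forwardFlow D (T - σ)) (toCLM L)
          (pt (x.fst + σ • x.snd) x.snd) ∧
        (∀ᶠ x' in 𝓝 (pt (x.fst + σ • x.snd) x.snd), ∃ y', Reach D (T - σ) x' y') ∧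
        Dispersive L x.snd y.snd (T - σ) := by
  -- After a collision the remaining trajectory starts on the boundary. The shift σ lets the
  -- induction hypothesis be applied a little later, at an interior point.
  induction h with
  | free q v t ht hfree =>
    intro σ hσ hσt _ hσD
    simp only [pt_fst, pt_snd] at *
    have hseg : ∀ᶠ x in 𝓝 (pt (q + σ • v) v), ∀ s ∈ Icc 0 (t - σ), x.fst + s • x.snd ∈ D := by
      refine eventually_segment_mem hD fun s hs => ?_
      rcases hs.1.eq_or_lt with h | h
      · rw [← h, zero_smul, add_zero]
        exact hσD
      · rw [add_assoc, ← add_smul]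
        exact hfree _ ⟨by linarith, by linarith [hs.2]⟩
    have hreach : ∀ᶠ x in 𝓝 (pt (q + σ • v) v),
        Reach D (t - σ) x (pt (x.fst + (t - σ) • x.snd) x.snd) :=
      hseg.mono fun x hx => Reach.free x.fst x.snd _ (by linarith) fun s hs => hx s ⟨hs.1.le, hs.2⟩
    exact ⟨flight (t - σ), (hasFDerivAt_flight _ _).congr_of_eventuallyEq
      (hreach.mono fun x hx => forwardFlow_eq hx), hreach.mono fun x hx => ⟨_, hx⟩,
      dispersive_flight v (by linarith)⟩
  | collide q v ν τ t y hτ hfree hν htrans hrest ih =>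
    intro σ hσ hσt hσfree hσD
    simp only [pt_fst, pt_snd] at *
    have hστ : σ < τ := by
      by_contra! hle
      exact hν.notMem (hσfree τ ⟨hτ, hle⟩)
    have e : q + σ • v + (τ - σ) • v = q + τ • v := by module
    have hν' := hν
    rw [← e] at hν'
    obtain ⟨δ, hδ, hδD, hstep⟩ := exists_collisionStep hD (sub_pos.2 hστ) (fun s hs => by
      rcases hs.1.eq_or_lt with h | h
      · rw [← h, zero_smul, add_zero]
        exact hσD
      · rw [add_assoc, ← add_smul]
        exact hfree _ ⟨by linarith, by linarith [hs.2]⟩) hν' htrans (hdisp _)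
    -- For t = 0 the trajectory would end at the collision point, which is not in D.
    have ht : 0 < t := by
      refine lt_of_le_of_ne hrest.nonneg ?_
      rintro rfl
      have h0 : Reach D 0 (pt (q + τ • v) (reflect ν v)) (pt (q + τ • v) (reflect ν v)) := by
        have := Reach.free (D := D) (q + τ • v) (reflect ν v) 0 le_rfl (by simp)
        rwa [zero_smul, add_zero] at this
      have := hrest.unique h0
      rw [this] at hy
      exact hν.notMem hy
    rw [e] at hδD hstep
    have hb : 0 < min δ t := lt_min hδ ht
    obtain ⟨g, L₁, hg, hgd, hL₁, hgr⟩ := hstep (min δ t) hb (min_le_left _ _)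
    obtain ⟨L₂, hd, hr, hL₂⟩ := ih hy (min δ t) hb.le (min_le_right _ _)
      (fun s hs => hδD s ⟨hs.1, hs.2.trans (min_le_left _ _)⟩)
      (hδD _ ⟨hb, min_le_left _ _⟩)
    rw [← hg] at hd hr
    have hT : τ + t - σ = τ - σ + min δ t + (t - min δ t) := by ring
    have hreach : ∀ᶠ x in 𝓝 (pt (q + σ • v) v),
        Reach D (τ + t - σ) x (forwardFlow D (t - min δ t) (g x)) := by
      filter_upwards [hgr, hgd.continuousAt.tendsto.eventually hr] with x hx ⟨y', hy'⟩
      rw [hT, forwardFlow_eq hy']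
      exact hx _ _ hy'
    refine ⟨L₂ ∘ₗ L₁, ?_, hreach.mono fun x hx => ⟨_, hx⟩, ?_⟩
    · refine ((hd.comp _ hgd).congr_fderiv ?_).congr_of_eventuallyEq
        (hreach.mono fun x hx => forwardFlow_eq hx)
      ext1 x
      rfl
    · rw [hT]
      exact hL₂.comp hL₁

end Flow

/-! ### Expansion of volumes -/

/-- The expansion factor only depends on a derivative of the map on the ambient space. -/
lemma expansionFactor_eq {V : Type*} [NormedAddCommGroup V] [InnerProductSpace ℝ V]
    [FiniteDimensional ℝ V] {Φ : V → V} {S : Set V} {x : V} {L : V →ₗ[ℝ] V}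
    (h : HasFDerivAt Φ (toCLM L) x) :
    expansionFactor Φ S x = volumeFactor L (tangentSpace S x) := by
  have h1 : (fderivWithin ℝ Φ S x : V →ₗ[ℝ] V) ∘ₗ (tangentSpace S x).subtype =
      L ∘ₗ (tangentSpace S x).subtype := by
    -- A derivative within S is determined only on the span of the tangent cone, which is all that
    -- the volume factor uses.
    have hle : tangentSpace S x ≤ LinearMap.eqLocus (fderivWithin ℝ Φ S x : V →ₗ[ℝ] V) L := by
      refine Submodule.span_le.2 fun u hu => ?_
      exact h.differentiableAt.differentiableWithinAt.hasFDerivWithinAt.unique_on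
        h.hasFDerivWithinAt hu
    ext1 u
    exact hle u.2
  rw [expansionFactor, volumeFactor, volumeFactor, h1]

lemma inner_phase {d : ℕ} (x y : Phase d) :
    inner ℝ x y = inner ℝ x.fst y.fst + inner ℝ x.snd y.snd := rfl

lemma norm_sq_phase {d : ℕ} (x : Phase d) : ‖x‖ ^ 2 = ‖x.fst‖ ^ 2 + ‖x.snd‖ ^ 2 := by
  rw [← real_inner_self_eq_norm_sq, inner_phase, real_inner_self_eq_norm_sq,
    real_inner_self_eq_norm_sq]

/-- A dispersive map expands the volume of a hypersurface of the phase space whose unit normal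
vector `n` satisfies `Q(n) ≤ -c` by at least the factor `1 + c * T`, once `T ≥ 1 / c`. -/
lemma Dispersive.le_volumeFactor {d : ℕ} {L : Phase d →ₗ[ℝ] Phase d} {q v v' : Space d} {T c : ℝ}
    (hL : Dispersive L v v' T) (hv : ‖v‖ = 1) (hc : 0 < c) (hT : 1 / c ≤ T)
    {W : Submodule ℝ (Phase d)} {n : Phase d} (hn : n ∈ phaseTangent (pt q v)) (hn1 : ‖n‖ = 1)
    (hW : ∀ u, u ∈ W ↔ u ∈ phaseTangent (pt q v) ∧ inner ℝ u n = 0) (hQ : lyapunov n ≤ -c) :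
    1 + c * T ≤ volumeFactor L W := by
  have hvv : inner ℝ v v = 1 := by rw [real_inner_self_eq_norm_sq, hv, one_pow]
  have hv' : ‖v'‖ = 1 := hL.norm_eq.trans hv
  have hvw : inner ℝ v n.snd = 0 := by rw [real_inner_comm]; exact hn
  -- The part of `n.fst` along the flow does not enter Q. It is split off, reappears as `α • v'`,
  -- and can only enlarge the final norm.
  set α := inner ℝ v n.fst with hα
  have hvz : inner ℝ v (n.fst - α • v) = 0 := by
    rw [inner_sub_right, real_inner_smul_right, hvv, mul_one, sub_self]
  have hQ' : inner ℝ (n.fst - α • v) n.snd = lyapunov n := by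
    rw [inner_sub_left, real_inner_smul_left, hvw, mul_zero, sub_zero, lyapunov]
  have hw0 : n.snd ≠ 0 := by
    intro h
    rw [lyapunov, h, inner_zero_right] at hQ
    linarith
  have hωpos := norm_pos_iff.2 hw0
  set ω := ‖n.snd‖ with hω
  have hu : c / ω * ω = c := div_mul_cancel₀ _ hωpos.ne'
  obtain ⟨z', w', hz', hw', he, h1, h2⟩ := hL.transport (n.fst - α • v) n.snd (c / ω) hvz hvw hw0
    (by positivity) (by rw [hQ', hu]; linarith)
  have hw'pos : 0 < ‖w'‖ := by
    have := mul_nonneg hL.nonneg (div_pos hc hωpos).le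
    linarith
  have hz'u : c / ω ≤ ‖z'‖ := by
    have h3 := neg_le_of_abs_le (abs_real_inner_le_norm z' w')
    exact le_of_mul_le_mul_right (by linarith) hw'pos
  -- The vector (0, v) is normal to the unit-speed level, so `phaseTangent` is its orthogonal
  -- complement.
  have hvol : volumeFactor L W = ‖pt (z' + α • v') w'‖ := by
    refine volumeFactor_eq_norm L W (e := pt 0 v) (n := n) (e' := pt 0 v') hL.det_sq ?_ hn1 ?_ ?_ ?_
      (fun u => ?_) (fun x => ?_) (fun x hx => ?_)
    · rw [← sq_eq_sq₀ (norm_nonneg _) zero_le_one, norm_sq_phase]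
      simp [hv]
    · simp [hvw]
    · rw [← sq_eq_sq₀ (norm_nonneg _) zero_le_one, norm_sq_phase]
      simp [hv']
    · simp [hw']
    · rw [hW, real_inner_comm u n, real_inner_comm u (pt 0 v)]
      refine and_congr_left fun _ => ?_
      rw [inner_phase, pt_fst, pt_snd, inner_zero_right, zero_add]
      rfl
    · simp [hL.inner_snd]
    · have hx' : inner ℝ v x.snd = 0 := by simpa [inner_phase] using hx
      have h3 := he x
      have h4 := hL.inner_fst x hx'
      simp only [inner_phase, pt_fst, pt_snd, inner_add_left, inner_sub_left,
        real_inner_smul_left] at h3 ⊢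
      rw [h4]
      linarith
  have hnorm : ‖pt (z' + α • v') w'‖ ^ 2 = ‖z'‖ ^ 2 + α ^ 2 + ‖w'‖ ^ 2 := by
    rw [norm_sq_phase, pt_fst, pt_snd, norm_add_sq_real, real_inner_smul_right, real_inner_comm,
      hz', norm_smul, hv', mul_one, Real.norm_eq_abs, sq_abs]
    ring
  have hn2 : ω ^ 2 ≤ 1 := by
    have := norm_sq_phase n
    rw [hn1] at this
    nlinarith [sq_nonneg ‖n.fst‖]
  have hcT : 1 ≤ c * T := by
    rw [div_le_iff₀ hc] at hT
    linarith
  set k := c / ω with hk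
  have hk0 : 0 < k := div_pos hc hωpos
  have hT0 := hL.nonneg
  have hkω : k * ω = c := hu
  have hckT : c * T ≤ T * k := by
    have hω1 : ω ≤ 1 := by nlinarith
    rw [← hkω]
    nlinarith [mul_nonneg hk0.le hT0]
  rw [hvol]
  refine (sq_le_sq₀ (by positivity) (norm_nonneg _)).1 ?_
  rw [hnorm]
  have hA : (ω + T * k) ^ 2 ≤ ‖w'‖ ^ 2 :=
    pow_le_pow_left₀ (by positivity) h2 2
  have hB : (T * k) ^ 2 - (c * T) ^ 2 = (T * k) ^ 2 * (1 - ω ^ 2) := by rw [← hkω]; ring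
  have hC : 1 ≤ (T * k) ^ 2 := one_le_pow₀ (hcT.trans hckT)
  have hE : ω * (T * k) = c * T := by rw [← hkω]; ring
  -- From ω · Tk = cT one gets (ω + Tk)² - (1 + cT)² = ((Tk)² - 1)(1 - ω²). Both factors are
  -- nonnegative, the first because Tk ≥ cT ≥ 1; this is where T ≥ 1/c is needed.
  nlinarith [mul_le_mul_of_nonneg_right hC (sub_nonneg.2 hn2), sq_nonneg ‖z'‖, sq_nonneg α]

end SemiDispersing

end

/-! ### The expansion theorem. -/

theorem mainTheorem1 {d : ℕ} (Λ : AddSubgroup (SemiDispersing.Space d)) [DiscreteTopology Λ]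
    (B : SemiDispersing.Table d Λ) (hB : B.IsSemiDispersing)
    (J : Set (SemiDispersing.Config Λ × SemiDispersing.Space d))
    (hJ : B.IsInvariantHypersurface J)
    (n₀ : SemiDispersing.Config Λ × SemiDispersing.Space d → SemiDispersing.Phase d)
    (hn₀ : ∀ y ∈ SemiDispersing.liftPhase J,
      SemiDispersing.IsUnitNormal (SemiDispersing.liftPhase J) y
        (n₀ (SemiDispersing.proj Λ y)))
    (c₀ : ℝ) (hc₀ : 0 < c₀)
    (hQ : ∀ x ∈ J, SemiDispersing.lyapunov (n₀ x) ≤ -c₀) :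
    ∀ y ∈ SemiDispersing.liftPhase J, ∀ t : ℝ, 1 / c₀ ≤ t → B.IsRegularUpTo t y →
      DifferentiableWithinAt ℝ (B.flow t) B.phaseSpace y ∧
      1 + c₀ * t ≤ SemiDispersing.expansionFactor (B.flow t) (SemiDispersing.liftPhase J) y := by
  intro y hy t ht ⟨x, hreach, hx⟩
  have ht0 : 0 ≤ t := (one_div_pos.2 hc₀).le.trans ht
  have hopen : IsOpen (SemiDispersing.liftConfig B.dom) :=
    B.isOpen_dom.preimage continuous_quotient_mk'
  have hyΩ := hJ.subset hy
  -- The point y lies inside the domain, so no shift of the starting point is needed.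
  obtain ⟨L, hd, -, hL⟩ := hreach.exists_hasFDerivAt hopen hB hx 0 le_rfl ht0 (by simp)
    (by simpa using hyΩ.1)
  rw [zero_smul, add_zero, SemiDispersing.pt_eta, sub_zero] at hd
  rw [sub_zero] at hL
  have hflow : B.flow t = SemiDispersing.forwardFlow (SemiDispersing.liftConfig B.dom) t := by
    ext1 z
    rw [SemiDispersing.Table.flow, if_pos ht0]
  rw [hflow]
  refine ⟨hd.differentiableAt.differentiableWithinAt, ?_⟩
  rw [SemiDispersing.expansionFactor_eq hd]
  obtain ⟨hn, hn1, hT⟩ := hn₀ y hy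
  exact hL.le_volumeFactor (q := y.fst) hyΩ.2 hc₀ ht hn hn1 hT (hQ _ hy)
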